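/- Let $(\Omega,\mathcal A,\mathbb P)$ be a probability space, $p\in[1,\infty)$, $N\in\mathbb N$, and let $Y_1,Y_2,\dots\in L^p_+$ be independent non-negative claims. Let $z_{n+1}\ge 0$ be deterministic premium incomes, $\alpha_n\in(0,1)$ for $n=0,\dots,N-1$, and $\beta\in(0,1]$. Write $F_X(x)=\mathbb P(X\le x)$, $S_X=1-F_X$, $\mathrm{VaR}_\alpha(X)=\inf\{x\in\mathbb R: F_X(x)\ge\alpha\}$, $x^+=\max\{x,0\}$ and $v_n=\mathrm{VaR}_{\alpha_n}(Y_{n+1})$. Let $\mathcal F$ be the set of functions $f:\mathbb R_+\to\mathbb R_+$ with $f(t)\le t$ for all $t$ such that $f$ and $t\mapsto t-f(t)$ are increasing, with the topology of compact convergence and its Borel $\sigma$-algebra. For premium principles $\pi_{R,n}:L^p_+\to\bar{\mathbb R}$ with $\pi_{R,n}(Y_{n+1})<\infty$, write $\pi_{R,n}(f)=\pi_{R,n}(Y_{n+1}-f(Y_{n+1}))$ and $D_n(x)=\{f\in\mathcal F:\pi_{R,n}(f)\le x^+\}$. A policy is a sequence $\pi=(d_0,\dots,d_{N-1})$ of measurable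 maps $d_n$, defined on the feasible histories $h_n=(x_0,f_0,x_1,\dots,f_{n-1},x_n)$ (those with $f_k\in D_k(x_k)$ for all $k<n$), such that $d_n(h_n)\in D_n(x_n)$. It is Markov if $d_n$ depends on $x_n$ only. Its values are $V_{N\pi}=0$ and, with $f=d_n(h_n)$, $$V_{n\pi}(h_n)=\mathrm{VaR}_{\alpha_n}\Big(f(Y_{n+1})+\pi_{R,n}(f)-z_{n+1}-x_n+\beta V_{n+1\,\pi}\big(h_n,f,\;x_n+z_{n+1}-f(Y_{n+1})-\pi_{R,n}(f)\big)\Big).$$ A policy is optimal if it attains $\inf_{\pi}V_{n\pi}(h_n)$ (infimum over all policies) for all $n\le N$ and all feasible histories $h_n$; in particular it attains $V_0(x)=\inf_\pi V_{0\pi}(x)$ for every initial capital $x$. The static problem at $(n,x)$ is $$\min_{f\in D_n(x)}\ \mathrm{VaR}_{\alpha_n}(f(Y_{n+1}))+\pi_{R,n}(f).$$ For $0\le a\le v_n$ let $h_a(t)=\max\{\min\{a,t\},\,t-v_n+a\}$, the retained loss of a layer treaty with deductible $a$. The reduced problem at $(n,x)$ is to minimize $a+\pi_{R,n}(h_a)$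 over $a\in[0,v_n]$ with $\pi_{R,n}(h_a)\le x^+$. 1. (General premium principle.) Suppose that, for $n<N$, $\pi_{R,n}$ is law-invariant, monotone, normalized and has the Fatou property ($\liminf_k\pi_{R,n}(X_k)\ge\pi_{R,n}(X)$ whenever $X_k,X\in L^p_+$, $X_k\to X$ a.s. and $|X_k|\le B$ a.s. for some $B\in L^p$). Then: (a) every Markov policy $(d_0,\dots,d_{N-1})$ such that $d_n(x)$ solves the static problem at $(n,x)$ for all $n<N$ and $x\in\mathbb R$ is optimal; (b) if $a$ solves the reduced problem at $(n,x)$, then $h_a\in\mathcal F$ solves the static problem at $(n,x)$; (c) a Markov policy as in (a) exists, and it can be chosen with $d_n(x)=h_{a_n(x)}$ where $a_n(x)$ solves the reduced problem at $(n,x)$. 2. (Wang premium principle.) Suppose that, for $n<N$, $\pi_{R,n}(X)=(1+\theta_n)\int_0^\infty g_n(S_X(y))\,dy$ with $\theta_n\ge0$ and $g_n:[0,1]\to[0,1]$ increasing, left-continuous, $g_n(0)=0$, $g_n(1)=1$. Let $$a_n^*=\begin{cases}\inf\{a\in[0,v_n]:\ 1-(1+\theta_n)\,g_n(S_{Y_{n+1}}(a))\ge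 0\},& g_n(1-\alpha_n)<\frac1{1+\theta_n},\\ v_n,&\text{otherwise.}\end{cases}$$ Then, for all $n<N$ and $x\in\mathbb R$: (a) $\pi_{R,n}(h_a)=(1+\theta_n)\int_a^{v_n}g_n(S_{Y_{n+1}}(y))\,dy$ for $a\in[0,v_n]$; (b) $a_n^*\in[0,v_n]$ minimizes $a+\pi_{R,n}(h_a)$ over $[0,v_n]$, and $h_{a_n^*}$ minimizes $\mathrm{VaR}_{\alpha_n}(f(Y_{n+1}))+\pi_{R,n}(f)$ over all $f\in\mathcal F$; (c) the minimum $a_n(x)=\min\{a\in[a_n^*,v_n]:\pi_{R,n}(h_a)\le x^+\}$ exists and solves the reduced problem at $(n,x)$; (d) $d_n^*(x)=h_{a_n(x)}$, $n=0,\dots,N-1$, is a Markov policy, $d_n^*(x)$ solves the static problem at $(n,x)$, and $(d_0^*,\dots,d_{N-1}^*)$ is optimal. -/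

import Mathlib

open MeasureTheory ProbabilityTheory
open scoped NNReal ENNReal

noncomputable section

namespace Reinsurance

/-! ## Quantiles, premium principles -/

section RiskMeasures

variable {Ω : Type*} [MeasurableSpace Ω]

/-- The distribution function `F_X(x) = P(X ≤ x)`. -/
def distFun (P : Measure Ω) (X : Ω → ℝ) (x : ℝ) : ℝ := P.real {ω | X ω ≤ x}

/-- The survival function `S_X = 1 - F_X`. -/
def survival (P : Measure Ω) (X : Ω → ℝ) (x : ℝ) : ℝ := 1 - distFun P X x

/-- Value-at-Risk at level `u`, i.e. the quantile `inf {x : F_X(x) ≥ u}`; it is a genuine real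
number for `u ∈ (0,1)`. -/
def VaR (P : Measure Ω) (u : ℝ) (X : Ω → ℝ) : ℝ := sInf {x : ℝ | u ≤ distFun P X x}

/-- Membership in `L^p_+`: the non-negative random variables with integrable `p`-th moment. -/
def MemLpPos (P : Measure Ω) (p : ℝ≥0∞) (X : Ω → ℝ) : Prop :=
  MemLp X p P ∧ 0 ≤ᵐ[P] X

/-- A law-invariant, monotone and normalized premium principle on `L^p_+` with values in the
extended reals that has the Fatou property (values of `π` outside `L^p_+` are irrelevant). -/
structure IsPremiumPrinciple (P : Measure Ω) (p : ℝ≥0∞) (π : (Ω → ℝ) → EReal) : Prop where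
  law_invariant : ∀ X X' : Ω → ℝ, MemLpPos P p X → MemLpPos P p X' →
    P.map X = P.map X' → π X = π X'
  monotone : ∀ X X' : Ω → ℝ, MemLpPos P p X → MemLpPos P p X' → X ≤ᵐ[P] X' → π X ≤ π X'
  normalized : π (fun _ => 0) = 0
  fatou : ∀ (X : ℕ → Ω → ℝ) (X' B : Ω → ℝ), (∀ k, MemLpPos P p (X k)) → MemLpPos P p X' →
    MemLp B p P → (∀ k, ∀ᵐ ω ∂P, |X k ω| ≤ B ω) →
    (∀ᵐ ω ∂P, Filter.Tendsto (fun k => X k ω) Filter.atTop (nhds (X' ω))) →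
    π X' ≤ Filter.liminf (fun k => π (X k)) Filter.atTop

/-- A distortion function: an increasing `g : [0,1] → [0,1]` with `g(0) = 0` and `g(1) = 1`
(values of `g` outside `[0,1]` are irrelevant). -/
structure IsDistortion (g : ℝ → ℝ) : Prop where
  monotoneOn : MonotoneOn g (Set.Icc 0 1)
  map_zero : g 0 = 0
  map_one : g 1 = 1

/-- Left-continuity of a function on `[0,1]`. -/
def IsLeftContinuous (g : ℝ → ℝ) : Prop :=
  ∀ u ∈ Set.Icc (0 : ℝ) 1, ContinuousWithinAt g (Set.Icc 0 u) u

/-- The Wang premium principle `(1 + θ) ∫₀^∞ g(S_X(x)) dx`, with values in `[0, ∞]`. -/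
def wangPremium (P : Measure Ω) (g : ℝ → ℝ) (θ : ℝ) (X : Ω → ℝ) : EReal :=
  ((ENNReal.ofReal (1 + θ) *
    ∫⁻ x in Set.Ioi (0 : ℝ), ENNReal.ofReal (g (survival P X x)) : ℝ≥0∞) : EReal)

end RiskMeasures

/-! ## Retained loss functions -/

/-- The set of admissible retained loss functions: `f : ℝ₊ → ℝ₊` with `f ≤ id`, `f` increasing and
`id - f` increasing. Such functions are 1-Lipschitz, so nothing is lost by taking them inside
`C(ℝ₊, ℝ)`, whose (compact-open) topology is that of compact convergence. -/
def RetainedLoss : Type :=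
  {f : C(ℝ≥0, ℝ) // (∀ t, 0 ≤ f t) ∧ (∀ t, f t ≤ t) ∧ Monotone f ∧ Monotone fun t : ℝ≥0 => (t : ℝ) - f t}

instance : TopologicalSpace RetainedLoss :=
  inferInstanceAs (TopologicalSpace {f : C(ℝ≥0, ℝ) //
    (∀ t, 0 ≤ f t) ∧ (∀ t, f t ≤ t) ∧ Monotone f ∧ Monotone fun t : ℝ≥0 => (t : ℝ) - f t})

instance : MeasurableSpace RetainedLoss := borel RetainedLoss

instance : BorelSpace RetainedLoss := ⟨rfl⟩

instance : CoeFun RetainedLoss (fun _ => ℝ≥0 → ℝ) := ⟨fun f => f.1⟩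

/-- The retained loss function `h_a(t) = max {min {a, t}, t - v + a}` of a layer treaty with
deductible `a` and upper bound `v - a` (used for `0 ≤ a ≤ v`). -/
def layer (v a : ℝ) (t : ℝ≥0) : ℝ := max (min a t) (t - v + a)

/-! ## The dynamic model -/

/-- Histories `(x₀, f₀, x₁, …, f_{n-1}, x_n)` up to time `n`. -/
abbrev History (n : ℕ) : Type := (Fin (n + 1) → ℝ) × (Fin n → RetainedLoss)

/-- The current state `x_n` of a history up to time `n`. -/
def History.last {n : ℕ} (h : History n) : ℝ := h.1 (Fin.last n)

/-- Extension of a history by an action and the next state. -/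
def History.append {n : ℕ} (h : History n) (f : RetainedLoss) (x : ℝ) : History (n + 1) :=
  (Fin.snoc (α := fun _ => ℝ) h.1 x, Fin.snoc (α := fun _ => RetainedLoss) h.2 f)

/-- The data of the reinsurance model with Value-at-Risk in each period and deterministic premium
income. -/
structure Model (Ω : Type*) [MeasurableSpace Ω] where
  /-- the underlying probability measure -/
  P : Measure Ω
  /-- the planning horizon -/
  N : ℕ
  /-- `Y n` are the aggregate claims arriving at time `n = 1, 2, …` -/
  Y : ℕ → Ω → ℝ≥0
  /-- `z n` is the premium income received at time `n = 1, 2, …` -/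
  z : ℕ → ℝ
  /-- `α n` is the Value-at-Risk level of period `[n, n+1)` -/
  α : ℕ → ℝ
  /-- the discount factor -/
  β : ℝ
  /-- `premium n` is the reinsurance premium principle of period `[n, n+1)` -/
  premium : ℕ → (Ω → ℝ) → EReal

namespace Model

variable {Ω : Type*} [MeasurableSpace Ω] (M : Model Ω)

/-- The claims of period `[n, n+1)` as a real random variable. -/
def claim (n : ℕ) : Ω → ℝ := fun ω => (M.Y (n + 1) ω : ℝ)

/-- `VaR_{α_n}(Y_{n+1})`. -/
def claimVaR (n : ℕ) : ℝ := VaR M.P (M.α n) (M.claim n)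

/-- The reinsurance premium `π_{R,n}(f) = π_{R,n}(Y_{n+1} - f(Y_{n+1}))`. -/
def cededPremium (n : ℕ) (f : ℝ≥0 → ℝ) : EReal :=
  M.premium n (fun ω => M.claim n ω - f (M.Y (n + 1) ω))

/-- The premium as a real number; for retained loss functions it lies in `[0, π_{R,n}(Y_{n+1})]`
and is hence finite under the standing assumptions. -/
def price (n : ℕ) (f : ℝ≥0 → ℝ) : ℝ := (M.cededPremium n f).toReal

/-- The budget constraint `D_n(x) = {f : π_{R,n}(f) ≤ x⁺}`. -/
def D (n : ℕ) (x : ℝ) : Set RetainedLoss :=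
  {f | M.cededPremium n f ≤ ((max x 0 : ℝ) : EReal)}

/-- The feasible histories up to time `n`. -/
def H (n : ℕ) : Set (History n) :=
  {h | ∀ k : Fin n, h.2 k ∈ M.D k (h.1 k.castSucc)}

/-- `d = (d_0, …, d_{N-1})` is an `N`-stage policy: every `d_n` is a measurable map on the feasible
histories with `d_n(h_n) ∈ D_n(x_n)` (values elsewhere are irrelevant). -/
def IsPolicy (d : (n : ℕ) → History n → RetainedLoss) : Prop :=
  ∀ n < M.N, Measurable (fun h : M.H n => d n h.1) ∧ ∀ h ∈ M.H n, d n h ∈ M.D n h.last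

/-- The recursive cost of capital under `d` at time `n`, when `m` periods remain. -/
def valueAux (d : (n : ℕ) → History n → RetainedLoss) : (m n : ℕ) → History n → ℝ
  | 0, _, _ => 0
  | m + 1, n, h => VaR M.P (M.α n) fun ω =>
      d n h (M.Y (n + 1) ω) + M.price n (d n h) - M.z (n + 1) - h.last
        + M.β * valueAux d m (n + 1) (h.append (d n h)
            (h.last + M.z (n + 1) - d n h (M.Y (n + 1) ω) - M.price n (d n h)))

/-- The policy value `V_{nπ}(h_n)` with planning horizon `N`. -/
def value (d : (n : ℕ) → History n → RetainedLoss) (n : ℕ) (h : History n) : ℝ :=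
  M.valueAux d (M.N - n) n h

/-- Optimality of a policy: it attains the infimum over all (history-dependent) policies for every
initial capital (`n = 0`), and also at every later time and feasible history. -/
def IsOptimal (d : (n : ℕ) → History n → RetainedLoss) : Prop :=
  M.IsPolicy d ∧ ∀ d' : (n : ℕ) → History n → RetainedLoss, M.IsPolicy d' →
    ∀ n ≤ M.N, ∀ h ∈ M.H n, M.value d n h ≤ M.value d' n h

/-- The objective `VaR_{α_n}(f(Y_{n+1})) + π_{R,n}(f)` of the static problem. -/
def staticCost (n : ℕ) (f : ℝ≥0 → ℝ) : ℝ :=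
  VaR M.P (M.α n) (fun ω => f (M.Y (n + 1) ω)) + M.price n f

/-- `f` solves the static budget-constrained problem `min_{f ∈ D_n(x)} VaR(f(Y)) + π(f)`. -/
def IsStaticMin (n : ℕ) (x : ℝ) (f : RetainedLoss) : Prop :=
  f ∈ M.D n x ∧ ∀ f' ∈ M.D n x, M.staticCost n f ≤ M.staticCost n f'

/-- The parameters `a ∈ [lo, VaR_{α_n}(Y_{n+1})]` for which the layer treaty `h_a` satisfies the
budget constraint in state `x`. -/
def feasibleParams (n : ℕ) (lo x : ℝ) : Set ℝ :=
  {a | a ∈ Set.Icc lo (M.claimVaR n) ∧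
    M.cededPremium n (layer (M.claimVaR n) a) ≤ ((max x 0 : ℝ) : EReal)}

/-- The objective `a + π_{R,n}(h_a)` of the reduced problem. -/
def layerCost (n : ℕ) (a : ℝ) : ℝ := a + M.price n (layer (M.claimVaR n) a)

/-- `a` solves the reduced problem: minimize `a + π_{R,n}(h_a)` over `0 ≤ a ≤ VaR_{α_n}(Y_{n+1})`
subject to `π_{R,n}(h_a) ≤ x⁺`. -/
def IsReducedMin (n : ℕ) (x a : ℝ) : Prop :=
  a ∈ M.feasibleParams n 0 x ∧ ∀ b ∈ M.feasibleParams n 0 x, M.layerCost n a ≤ M.layerCost n b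

/-- The parameter `a*_n`: the generalized inverse at `0` of
`ψ'(a) = 1 - (1 + θ) g(S_{Y_{n+1}}(a))` if `g(1 - α_n) < 1 / (1 + θ)`, and `VaR_{α_n}(Y_{n+1})`
otherwise. -/
def aStar (g : ℝ → ℝ) (θ : ℝ) (n : ℕ) : ℝ :=
  open Classical in
  if g (1 - M.α n) < 1 / (1 + θ) then
    sInf {a | a ∈ Set.Icc 0 (M.claimVaR n) ∧
      0 ≤ 1 - (1 + θ) * g (survival M.P (M.claim n) a)}
  else M.claimVaR n

/-- The parameter `a_n(x) = min {a ∈ [a*_n, VaR_{α_n}(Y_{n+1})] : π_{R,n}(h_a) ≤ x⁺}`. -/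
def aOpt (g : ℝ → ℝ) (θ : ℝ) (n : ℕ) (x : ℝ) : ℝ :=
  sInf (M.feasibleParams n (M.aStar g θ n) x)

end Model

/-- The Markov policy given by decision rules that depend on the current state only. -/
def markov (δ : ℕ → ℝ → RetainedLoss) : (n : ℕ) → History n → RetainedLoss :=
  fun n h => δ n h.last

end Reinsurance

end

noncomputable section

namespace Reinsurance

open Filter Topology Set

/-! ## Value-at-Risk -/

section VaR

/-! Quantiles commute with increasing left-continuous functions (`VaR_comp`), and this collapses the
dynamic problem. If the continuation cost `U` is decreasing and right-continuous in capital, the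
one-period cost is an increasing left-continuous function of the retained loss. `VaR` therefore
passes inside, and a treaty enters only through its static cost `s = VaR(f(Y)) + π(f)`, increasingly
(`IsAdmissible.VaR_step`, `monotone_step`). Minimizing `s` in each state is then optimal: backward
induction bounds every history-dependent policy below by `optCost` (`optCost_le_valueAux`), and
myopic Markov policies attain it (`valueAux_markov`).

For the static problem put `v = VaR(Y)`. Then `VaR(f(Y)) = f(v)`, and the layer with deductible
`f(v)` lies above `f` and agrees with it at `v`, so it costs no more premium (`exists_layer_le`).
One parameter in `[0, v]` remains. The Fatou property makes the premium lower semicontinuous in it,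
which with compactness gives minimizers and right-continuity of the minimal value. The greatest
minimizer decreases in capital, hence is Borel, so the policy is measurable.

A Wang premium has the Fatou property because `g` is left-continuous. The cost of a layer is `a +
∫_a^v (1+θ) g(S(y)) dy`, whose marginal `1 - (1+θ) g(S(a))` changes sign at `a*`: the cost falls
before `a*` and rises after it. As feasibility persists when the deductible grows, the least
feasible deductible above `a*` is optimal. -/

theorem lowerBound_VaR {Ω : Type*} [MeasurableSpace Ω] {P : Measure Ω} {u : ℝ} (hu : 0 < u) {X : Ω → ℝ} {c : ℝ} (hX : ∀ ω, c ≤ X ω) :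
    c ∈ lowerBounds {x | u ≤ distFun P X x} := by
  intro x hx
  by_contra! hlt
  have : {ω | X ω ≤ x} = ∅ := by
    ext ω
    simpa using hlt.trans_le (hX ω)
  have h0 : distFun P X x = 0 := by simp [distFun, this]
  rw [mem_ofPred_eq, h0] at hx
  exact absurd hx hu.not_ge

/-- The pointwise bound `c` keeps the defining set bounded below; otherwise `sInf` could take its
default value `0`. -/
theorem VaR_le {Ω : Type*} [MeasurableSpace Ω] {P : Measure Ω} {u : ℝ} (hu : 0 < u) {X : Ω → ℝ} {c x : ℝ} (hX : ∀ ω, c ≤ X ω) (hx : u ≤ distFun P X x) :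
    VaR P u X ≤ x :=
  csInf_le ⟨c, lowerBound_VaR hu hX⟩ hx

variable {Ω : Type*} [MeasurableSpace Ω] {P : Measure Ω} [IsProbabilityMeasure P] {u : ℝ}

theorem distFun_anti {X X' : Ω → ℝ} (h : ∀ ω, X ω ≤ X' ω) (x : ℝ) :
    distFun P X' x ≤ distFun P X x :=
  measureReal_mono fun ω hω => (h ω).trans hω

theorem distFun_mono (X : Ω → ℝ) : Monotone (distFun P X) := fun _ _ hxy =>
  measureReal_mono fun _ hω => le_trans hω hxy

theorem distFun_le_one (X : Ω → ℝ) (x : ℝ) : distFun P X x ≤ 1 := measureReal_le_one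

theorem survival_antitone (X : Ω → ℝ) : Antitone (survival P X) := fun _ _ hxy =>
  sub_le_sub_left (distFun_mono (P := P) X hxy) 1

theorem survival_mem_Icc (X : Ω → ℝ) (x : ℝ) : survival P X x ∈ Icc (0 : ℝ) 1 :=
  ⟨sub_nonneg.2 (distFun_le_one X x), sub_le_self 1 (measureReal_nonneg)⟩

theorem exists_le_distFun (hu : u < 1) (X : Ω → ℝ) : ∃ x, u ≤ distFun P X x := by
  have hmono : Monotone fun k : ℕ => {ω | X ω ≤ k} := fun i j hij ω hω =>
    le_trans (show X ω ≤ i from hω) (by exact_mod_cast hij)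
  have h := tendsto_measure_iUnion_atTop (μ := P) hmono
  have hU : ⋃ k : ℕ, {ω | X ω ≤ k} = univ :=
    eq_univ_of_forall fun ω => mem_iUnion.2 (exists_nat_ge (X ω))
  rw [hU, measure_univ] at h
  have h' := (ENNReal.tendsto_toReal ENNReal.one_ne_top).comp h
  rw [ENNReal.toReal_one] at h'
  obtain ⟨k, hk⟩ := (h'.eventually (lt_mem_nhds hu)).exists
  exact ⟨k, hk.le⟩

theorem le_VaR (hu : u ∈ Ioo (0 : ℝ) 1) {X : Ω → ℝ} {c : ℝ} (hX : ∀ ω, c ≤ X ω) :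
    c ≤ VaR P u X :=
  le_csInf (exists_le_distFun hu.2 X) (lowerBound_VaR hu.1 hX)

/-- Holds for arbitrary functions. This matters because it is applied to the continuation values of
arbitrary policies, whose measurability is never established. -/
theorem VaR_mono (hu : u ∈ Ioo (0 : ℝ) 1) {X X' : Ω → ℝ} {c : ℝ} (hX : ∀ ω, c ≤ X ω)
    (h : ∀ ω, X ω ≤ X' ω) : VaR P u X ≤ VaR P u X' :=
  le_csInf (exists_le_distFun hu.2 X') fun x hx =>
    VaR_le hu.1 hX (le_trans (show u ≤ distFun P X' x from hx) (distFun_anti (P := P) h x))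

/-- The infimum is attained because distribution functions are right-continuous, by continuity from
above along `q + 1/(k+1)`. -/
theorem le_distFun_VaR (hu : u < 1) {X : Ω → ℝ} (hXm : Measurable X) :
    u ≤ distFun P X (VaR P u X) := by
  set q := VaR P u X
  have hgt : ∀ y, q < y → u ≤ distFun P X y := fun y hy => by
    obtain ⟨x, hx, hxy⟩ := exists_lt_of_csInf_lt (exists_le_distFun hu X) hy
    exact le_trans hx (distFun_mono X hxy.le)
  have hanti : Antitone fun k : ℕ => {ω | X ω ≤ q + 1 / ((k : ℝ) + 1)} := fun i j hij ω hω =>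
    le_trans (show X ω ≤ q + 1 / ((j : ℝ) + 1) from hω) (by gcongr)
  have h := tendsto_measure_iInter_atTop (μ := P)
    (fun k => (measurableSet_le hXm measurable_const).nullMeasurableSet) hanti
    ⟨0, measure_ne_top _ _⟩
  have hU : ⋂ k : ℕ, {ω | X ω ≤ q + 1 / ((k : ℝ) + 1)} = {ω | X ω ≤ q} := by
    ext ω
    simp only [mem_iInter, mem_ofPred_eq]
    refine ⟨fun H => ?_, fun H k => H.trans ?_⟩
    · have hlim : Tendsto (fun k : ℕ => q + 1 / ((k : ℝ) + 1)) atTop (𝓝 (q + 0)) :=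
        tendsto_const_nhds.add tendsto_one_div_add_atTop_nhds_zero_nat
      rw [add_zero] at hlim
      exact ge_of_tendsto' hlim H
    · exact le_add_of_nonneg_right (by positivity)
  rw [hU] at h
  have h' := (ENNReal.tendsto_toReal (measure_ne_top P _)).comp h
  exact ge_of_tendsto' h' fun k => hgt _ (lt_add_of_pos_right q (by positivity))

/-- Quantiles commute with increasing left-continuous functions. -/
theorem VaR_comp (hu : u ∈ Ioo (0 : ℝ) 1) {X : Ω → ℝ} (hXm : Measurable X) {c : ℝ}
    (hX : ∀ ω, c ≤ X ω) {φ : ℝ → ℝ} (hφ : Monotone φ)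
    (hφc : ContinuousWithinAt φ (Iic (VaR P u X)) (VaR P u X)) :
    VaR P u (fun ω => φ (X ω)) = φ (VaR P u X) := by
  apply le_antisymm
  · refine VaR_le hu.1 (fun ω => hφ (hX ω)) ((le_distFun_VaR (P := P) hu.2 hXm).trans ?_)
    exact measureReal_mono fun ω hω => hφ hω
  · refine le_csInf (exists_le_distFun (P := P) hu.2 _) fun y hy => ?_
    by_contra! hlt
    -- Left-continuity yields `s` below the quantile with `y < φ s`. Then `φ(X) ≤ y` forces `X ≤ s`,
    -- so `s` would already reach level `u`.
    have hev : ∀ᶠ s in 𝓝[<] VaR P u X, y < φ s :=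
      (hφc.mono Iio_subset_Iic_self).eventually (lt_mem_nhds hlt)
    obtain ⟨s, hs, hsq⟩ := (hev.and self_mem_nhdsWithin).exists
    refine absurd (VaR_le hu.1 hX (le_trans (show u ≤ distFun P (fun ω => φ (X ω)) y from hy) ?_))
      (not_le.2 hsq)
    refine measureReal_mono fun ω hω => ?_
    by_contra! hlt'
    exact absurd (hs.trans_le (hφ (le_of_lt (not_le.1 hlt')))) (not_lt.2 hω)

end VaR

/-! ## Retained loss functions and layers -/

namespace RetainedLoss

theorem nonneg (f : RetainedLoss) (t : ℝ≥0) : 0 ≤ f t := f.2.1 t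

theorem le_id (f : RetainedLoss) (t : ℝ≥0) : f t ≤ t := f.2.2.1 t

theorem mono (f : RetainedLoss) {s t : ℝ≥0} (h : s ≤ t) : f s ≤ f t := f.2.2.2.1 h

theorem sub_mono (f : RetainedLoss) {s t : ℝ≥0} (h : s ≤ t) : (s : ℝ) - f s ≤ t - f t :=
  f.2.2.2.2 h

theorem continuous (f : RetainedLoss) : Continuous f := f.1.continuous

/-- The layer treaty dominates every treaty with the same retention at `v`. -/
theorem le_layer (f : RetainedLoss) (v t : ℝ≥0) : f t ≤ layer v (f v) t := by
  rcases le_total t v with h | h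
  · exact le_max_of_le_left (le_min (f.mono h) (f.le_id t))
  · exact le_max_of_le_right (by linarith [f.sub_mono h])

end RetainedLoss

theorem layer_mono (v : ℝ) (t : ℝ≥0) : Monotone fun a => layer v a t := fun a b h => by
  dsimp only [layer]
  gcongr

theorem layer_eq_id (v : ℝ) (t : ℝ≥0) : layer v v t = t := by
  simp [layer]

theorem layer_self (a : ℝ) (v : ℝ≥0) (h : a ≤ v) : layer v a v = a := by
  simp [layer, h]

/-- The layer treaties as admissible retained loss functions. -/
def layerLoss (v : ℝ) (a : Icc (0 : ℝ) v) : RetainedLoss :=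
  ⟨⟨layer v a, by unfold layer; fun_prop⟩,
    fun t => le_max_of_le_left (le_min a.2.1 t.2),
    fun t => max_le (min_le_right _ _) (by linarith [a.2.2]),
    fun s t h => max_le_max (min_le_min_left _ h)
      (by linarith [show (s : ℝ) ≤ t from h]),
    fun s t h => by
      have h' : (s : ℝ) ≤ t := h
      have ha := a.2.2
      simp only [ContinuousMap.coe_mk, layer]
      rcases max_cases (min (a : ℝ) s) (s - v + a) with h1 | h1 <;>
      rcases max_cases (min (a : ℝ) t) (t - v + a) with h2 | h2 <;>
      rcases min_cases (a : ℝ) s with h3 | h3 <;>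
      rcases min_cases (a : ℝ) t with h4 | h4 <;> linarith⟩

theorem layerLoss_apply (v : ℝ) (a : Icc (0 : ℝ) v) (t : ℝ≥0) : layerLoss v a t = layer v a t :=
  rfl

/-- Joint continuity in deductible and claim gives, by currying, continuity into the compact-open
topology. It turns a Borel deductible into a measurable decision rule. -/
theorem continuous_layerLoss (v : ℝ) : Continuous (layerLoss v) := by
  refine Continuous.subtype_mk ?_ _
  refine ContinuousMap.continuous_of_continuous_uncurry _ ?_
  simp only [Function.uncurry_def, ContinuousMap.coe_mk, layer]
  fun_prop

/-! ## The reduced problem -/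

namespace Model

variable {Ω : Type*} [MeasurableSpace Ω] (M : Model Ω)

/-- The standing assumptions on the period `[n, n+1)`. -/
structure IsAdmissible (p : ℝ≥0∞) (n : ℕ) : Prop where
  isProbabilityMeasure : IsProbabilityMeasure M.P
  measurable_Y : Measurable (M.Y (n + 1))
  memLp_claim : MemLp (M.claim n) p M.P
  α_mem : M.α n ∈ Ioo (0 : ℝ) 1
  premium_claim_lt_top : M.premium n (M.claim n) < ⊤
  isPremiumPrinciple : IsPremiumPrinciple M.P p (M.premium n)

variable {M} {p : ℝ≥0∞} {n : ℕ}

theorem claim_nonneg (ω : Ω) : 0 ≤ M.claim n ω := NNReal.coe_nonneg _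

/-- The ceded loss is a non-negative random variable dominated by the claim. -/
theorem memLpPos_ceded (hYm : Measurable (M.Y (n + 1))) (hYp : MemLp (M.claim n) p M.P)
    (f : RetainedLoss) : MemLpPos M.P p fun ω => M.claim n ω - f (M.Y (n + 1) ω) := by
  have h0 : ∀ ω, 0 ≤ M.claim n ω - f (M.Y (n + 1) ω) := fun ω => sub_nonneg.2 (f.le_id _)
  refine ⟨hYp.mono ?_ (ae_of_all _ fun ω => ?_), ae_of_all _ h0⟩
  · exact (hYm.coe_nnreal_real.sub (f.continuous.measurable.comp hYm)).aestronglyMeasurable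
  · rw [Real.norm_of_nonneg (h0 ω), Real.norm_of_nonneg (claim_nonneg ω)]
    exact sub_le_self _ (f.nonneg _)

theorem VaR_retained [IsProbabilityMeasure M.P] (hYm : Measurable (M.Y (n + 1)))
    (hα : M.α n ∈ Ioo (0 : ℝ) 1) (f : RetainedLoss) :
    VaR M.P (M.α n) (fun ω => f (M.Y (n + 1) ω)) = f (M.claimVaR n).toNNReal := by
  have hm : Measurable (M.claim n) := hYm.coe_nnreal_real
  have h := VaR_comp (P := M.P) hα hm claim_nonneg (φ := fun s => f s.toNNReal)
    (fun a b hab => f.mono (Real.toNNReal_mono hab))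
    (f.continuous.comp continuous_real_toNNReal).continuousWithinAt
  rw [claimVaR, ← h]
  simp only [claim, Real.toNNReal_coe]

theorem claimVaR_nonneg [IsProbabilityMeasure M.P] (hα : M.α n ∈ Ioo (0 : ℝ) 1) :
    0 ≤ M.claimVaR n :=
  le_VaR hα claim_nonneg

theorem retained_mem_Icc [IsProbabilityMeasure M.P] (hα : M.α n ∈ Ioo (0 : ℝ) 1)
    (f : RetainedLoss) : f (M.claimVaR n).toNNReal ∈ Icc 0 (M.claimVaR n) :=
  ⟨f.nonneg _, (f.le_id _).trans_eq (Real.coe_toNNReal _ (claimVaR_nonneg hα))⟩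

theorem feasibleParams_mono {lo x y : ℝ} (h : x ≤ y) :
    M.feasibleParams n lo x ⊆ M.feasibleParams n lo y := fun _ ha =>
  ⟨ha.1, ha.2.trans (EReal.coe_le_coe_iff.2 (max_le_max_right 0 h))⟩

/-- The minimal value of the reduced problem. -/
def reducedValue (M : Model Ω) (n : ℕ) (x : ℝ) : ℝ :=
  sInf (M.layerCost n '' M.feasibleParams n 0 x)

theorem IsReducedMin.layerCost_eq {x a : ℝ} (h : M.IsReducedMin n x a) :
    M.layerCost n a = M.reducedValue n x :=
  (IsLeast.csInf_eq ⟨mem_image_of_mem _ h.1, forall_mem_image.2 h.2⟩).symm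

namespace IsAdmissible

variable (h : M.IsAdmissible p n)
include h

theorem memLpPos_ceded (f : RetainedLoss) :
    MemLpPos M.P p fun ω => M.claim n ω - f (M.Y (n + 1) ω) :=
  Model.memLpPos_ceded h.measurable_Y h.memLp_claim f

theorem cededPremium_anti {f f' : RetainedLoss} (hf : ∀ t, f t ≤ f' t) :
    M.cededPremium n f' ≤ M.cededPremium n f :=
  h.isPremiumPrinciple.monotone _ _ (h.memLpPos_ceded f') (h.memLpPos_ceded f)
    (ae_of_all _ fun _ => sub_le_sub_left (hf _) _)

theorem cededPremium_nonneg (f : RetainedLoss) : 0 ≤ M.cededPremium n f := by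
  rw [← h.isPremiumPrinciple.normalized]
  refine h.isPremiumPrinciple.monotone _ _ ⟨MemLp.zero', ae_of_all _ fun _ => le_rfl⟩
    (h.memLpPos_ceded f) (h.memLpPos_ceded f).2

theorem cededPremium_lt_top (f : RetainedLoss) : M.cededPremium n f < ⊤ := by
  refine lt_of_le_of_lt (h.isPremiumPrinciple.monotone _ _ (h.memLpPos_ceded f)
    ⟨h.memLp_claim, ae_of_all _ claim_nonneg⟩ (ae_of_all _ fun ω => ?_)) h.premium_claim_lt_top
  exact sub_le_self _ (f.nonneg _)

/-- The premium lies between `0` and that of the full claim, so the `toReal` in `price`, which would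
send `⊤` to `0`, loses nothing. -/
theorem coe_price (f : RetainedLoss) : (M.price n f : EReal) = M.cededPremium n f :=
  EReal.coe_toReal (h.cededPremium_lt_top f).ne
    (ne_of_gt (lt_of_lt_of_le EReal.bot_lt_zero (h.cededPremium_nonneg f)))

theorem coe_price_layer {a : ℝ} (ha : a ∈ Icc 0 (M.claimVaR n)) :
    (M.price n (layer (M.claimVaR n) a) : EReal) = M.cededPremium n (layer (M.claimVaR n) a) :=
  h.coe_price (layerLoss _ ⟨a, ha⟩)

theorem price_anti {f f' : RetainedLoss} (hf : ∀ t, f t ≤ f' t) :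
    M.price n f' ≤ M.price n f := by
  rw [← EReal.coe_le_coe_iff, h.coe_price, h.coe_price]
  exact h.cededPremium_anti hf

theorem claimVaR_nonneg : 0 ≤ M.claimVaR n :=
  have := h.isProbabilityMeasure
  Model.claimVaR_nonneg h.α_mem

theorem staticCost_eq (f : RetainedLoss) :
    M.staticCost n f = f (M.claimVaR n).toNNReal + M.price n f := by
  have := h.isProbabilityMeasure
  rw [staticCost, VaR_retained h.measurable_Y h.α_mem f]

theorem staticCost_layer (a : Icc 0 (M.claimVaR n)) :
    M.staticCost n (layer (M.claimVaR n) a) = M.layerCost n a := by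
  have h1 := h.staticCost_eq (layerLoss (M.claimVaR n) a)
  have h2 : layerLoss (M.claimVaR n) a (M.claimVaR n).toNNReal = a := by
    have h3 := layer_self a (M.claimVaR n).toNNReal
    rw [Real.coe_toNNReal _ h.claimVaR_nonneg] at h3
    exact h3 a.2.2
  rw [h2] at h1
  exact h1

/-- Every treaty is dominated by a layer treaty. -/
theorem exists_layer_le (f : RetainedLoss) : ∃ a ∈ Icc 0 (M.claimVaR n),
    M.cededPremium n (layer (M.claimVaR n) a) ≤ M.cededPremium n f ∧
      M.layerCost n a ≤ M.staticCost n f := by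
  have := h.isProbabilityMeasure
  -- The deductible is the retention of `f` at `v`: the quantile is unchanged while less is ceded.
  have ha := retained_mem_Icc h.α_mem f
  have hle : ∀ t, f t ≤ layerLoss (M.claimVaR n) ⟨_, ha⟩ t := fun t => by
    have h3 := f.le_layer (M.claimVaR n).toNNReal t
    rwa [Real.coe_toNNReal _ h.claimVaR_nonneg] at h3
  refine ⟨_, ha, h.cededPremium_anti hle, ?_⟩
  rw [h.staticCost_eq f, layerCost]
  exact add_le_add_right (h.price_anti hle) _

theorem isStaticMin_layerLoss {x : ℝ} {a : Icc 0 (M.claimVaR n)} (ha : M.IsReducedMin n x a) :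
    M.IsStaticMin n x (layerLoss (M.claimVaR n) a) := by
  refine ⟨ha.1.2, fun f hf => ?_⟩
  obtain ⟨b, hb, hbf, hbc⟩ := h.exists_layer_le f
  calc M.staticCost n (layerLoss (M.claimVaR n) a) = M.layerCost n a := h.staticCost_layer a
    _ ≤ M.layerCost n b := ha.2 b ⟨hb, hbf.trans hf⟩
    _ ≤ M.staticCost n f := hbc

/-- The Fatou property applies since ceded losses converge pointwise and are dominated by the claim.
The bounds `y k` may move, so varying budgets and varying costs are both covered. -/
theorem cededPremium_layer_le_of_tendsto {a y : ℕ → ℝ} {a' y' : ℝ}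
    (ha : ∀ k, a k ∈ Icc 0 (M.claimVaR n)) (ha' : Tendsto a atTop (𝓝 a'))
    (hy : Tendsto y atTop (𝓝 y'))
    (hle : ∀ k, M.cededPremium n (layer (M.claimVaR n) (a k)) ≤ y k) :
    M.cededPremium n (layer (M.claimVaR n) a') ≤ y' := by
  have ha'v : a' ∈ Icc 0 (M.claimVaR n) := isClosed_Icc.mem_of_tendsto ha' (.of_forall ha)
  have hF := h.isPremiumPrinciple.fatou
    (fun k ω => M.claim n ω - layer (M.claimVaR n) (a k) (M.Y (n + 1) ω))
    (fun ω => M.claim n ω - layer (M.claimVaR n) a' (M.Y (n + 1) ω)) (M.claim n)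
    (fun k => h.memLpPos_ceded (layerLoss _ ⟨a k, ha k⟩))
    (h.memLpPos_ceded (layerLoss _ ⟨a', ha'v⟩)) h.memLp_claim
    (fun k => ae_of_all _ fun ω => ?_) (ae_of_all _ fun ω => ?_)
  · refine hF.trans ((liminf_le_liminf (.of_forall hle)).trans_eq ?_)
    exact ((continuous_coe_real_ereal.tendsto y').comp hy).liminf_eq
  · have h1 := (layerLoss _ ⟨a k, ha k⟩).nonneg (M.Y (n + 1) ω)
    have h2 := (layerLoss _ ⟨a k, ha k⟩).le_id (M.Y (n + 1) ω)
    exact (abs_of_nonneg (sub_nonneg.2 h2)).trans_le (sub_le_self _ h1)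
  · refine tendsto_const_nhds.sub (Tendsto.comp (g := fun b => layer _ b (M.Y (n + 1) ω)) ?_ ha')
    refine Continuous.tendsto ?_ a'
    simp only [layer]
    fun_prop

theorem feasibleParams_of_tendsto {lo x' a' : ℝ} (hlo : 0 ≤ lo) {a x : ℕ → ℝ}
    (ha : ∀ k, a k ∈ M.feasibleParams n lo (x k)) (ha' : Tendsto a atTop (𝓝 a'))
    (hx : Tendsto x atTop (𝓝 x')) : a' ∈ M.feasibleParams n lo x' :=
  ⟨isClosed_Icc.mem_of_tendsto ha' (.of_forall fun k => (ha k).1),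
    h.cededPremium_layer_le_of_tendsto (fun k => Icc_subset_Icc_left hlo (ha k).1) ha'
      (hx.max tendsto_const_nhds) fun k => (ha k).2⟩

theorem layerCost_le_of_tendsto {a r : ℕ → ℝ} {a' r' : ℝ}
    (ha : ∀ k, a k ∈ Icc 0 (M.claimVaR n)) (ha' : Tendsto a atTop (𝓝 a'))
    (hr : Tendsto r atTop (𝓝 r')) (hle : ∀ k, M.layerCost n (a k) ≤ r k) :
    M.layerCost n a' ≤ r' := by
  have ha'v : a' ∈ Icc 0 (M.claimVaR n) := isClosed_Icc.mem_of_tendsto ha' (.of_forall ha)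
  -- A bound `r k` on the cost is a bound `r k - a k` on the premium.
  have h1 := h.cededPremium_layer_le_of_tendsto ha ha' (hr.sub ha') fun k => by
    rw [← h.coe_price_layer (ha k), EReal.coe_le_coe_iff]
    have := hle k
    simp only [layerCost] at this
    exact le_sub_iff_add_le'.2 this
  rw [← h.coe_price_layer ha'v, EReal.coe_le_coe_iff] at h1
  exact le_sub_iff_add_le'.1 h1

/-- With deductible `v` the layer is the identity: nothing is ceded, so the treaty is affordable at
any capital. -/
theorem claimVaR_mem_feasibleParams {lo : ℝ} (hlo : lo ≤ M.claimVaR n) (x : ℝ) :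
    M.claimVaR n ∈ M.feasibleParams n lo x := by
  refine ⟨⟨hlo, le_rfl⟩, ?_⟩
  have h0 : M.cededPremium n (layer (M.claimVaR n) (M.claimVaR n)) = 0 := by
    rw [← h.isPremiumPrinciple.normalized, cededPremium]
    congr 1
    funext ω
    rw [layer_eq_id, claim, sub_self]
  rw [h0]
  exact EReal.coe_le_coe_iff.2 (le_max_right x 0)

theorem layerCost_nonneg {a : ℝ} (ha : a ∈ Icc 0 (M.claimVaR n)) : 0 ≤ M.layerCost n a :=
  add_nonneg ha.1 (EReal.toReal_nonneg (h.cededPremium_nonneg (layerLoss _ ⟨a, ha⟩)))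

theorem reducedValue_le {x a : ℝ} (ha : a ∈ M.feasibleParams n 0 x) :
    M.reducedValue n x ≤ M.layerCost n a :=
  csInf_le ⟨0, forall_mem_image.2 fun _ hb => h.layerCost_nonneg hb.1⟩ (mem_image_of_mem _ ha)

/-- Compactness of `[0, v]` combined with lower semicontinuity. A constant capital sequence gives
existence of minimizers, a decreasing one right-continuity of the value. -/
theorem exists_layerCost_le_of_tendsto {a x r : ℕ → ℝ} {x' r' : ℝ}
    (ha : ∀ k, a k ∈ M.feasibleParams n 0 (x k)) (hx : Tendsto x atTop (𝓝 x'))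
    (hr : Tendsto r atTop (𝓝 r')) (hle : ∀ k, M.layerCost n (a k) ≤ r k) :
    ∃ a' ∈ M.feasibleParams n 0 x', M.layerCost n a' ≤ r' := by
  obtain ⟨a', -, φ, hφ, hlim⟩ := isCompact_Icc.tendsto_subseq fun k => (ha k).1
  exact ⟨a', h.feasibleParams_of_tendsto le_rfl (fun k => ha (φ k)) hlim
      (hx.comp hφ.tendsto_atTop),
    h.layerCost_le_of_tendsto (fun k => (ha (φ k)).1) hlim (hr.comp hφ.tendsto_atTop)
      fun k => hle (φ k)⟩

theorem exists_isReducedMin (x : ℝ) : ∃ a, M.IsReducedMin n x a := by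
  have hne : (M.layerCost n '' M.feasibleParams n 0 x).Nonempty :=
    ⟨_, mem_image_of_mem _ (h.claimVaR_mem_feasibleParams h.claimVaR_nonneg x)⟩
  obtain ⟨r, -, hr, hmem⟩ := exists_seq_tendsto_sInf hne
    ⟨0, forall_mem_image.2 fun _ hb => h.layerCost_nonneg hb.1⟩
  choose a ha hac using hmem
  obtain ⟨a', ha', hle⟩ := h.exists_layerCost_le_of_tendsto ha tendsto_const_nhds hr
    fun k => (hac k).le
  exact ⟨a', ha', fun b hb => hle.trans (h.reducedValue_le hb)⟩

/-- There is a greatest solution of the reduced problem. -/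
theorem exists_isGreatest (x : ℝ) : ∃ a, IsGreatest {a | M.IsReducedMin n x a} a := by
  obtain ⟨a₀, ha₀⟩ := h.exists_isReducedMin x
  have hbdd : BddAbove {a | M.IsReducedMin n x a} := ⟨M.claimVaR n, fun a ha => ha.1.1.2⟩
  obtain ⟨a, -, hlim, hmem⟩ := exists_seq_tendsto_sSup (S := {a | M.IsReducedMin n x a})
    ⟨a₀, ha₀⟩ hbdd
  refine ⟨_, ⟨h.feasibleParams_of_tendsto le_rfl (fun k => (hmem k).1) hlim tendsto_const_nhds,
    fun b hb => h.layerCost_le_of_tendsto (fun k => (hmem k).1.1) hlim tendsto_const_nhds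
      fun k => (hmem k).2 b hb⟩, fun b hb => le_csSup hbdd hb⟩

/-- The greatest solution of the reduced problem decreases in the capital. -/
theorem exists_antitone_isReducedMin :
    ∃ a : ℝ → ℝ, Antitone a ∧ ∀ x, M.IsReducedMin n x (a x) := by
  choose a ha using h.exists_isGreatest
  refine ⟨a, fun x y hxy => ?_, fun x => (ha x).1⟩
  -- If `a x < a y`, the larger deductible `a y` cedes less, so it is feasible at `x`. Being optimal
  -- for the larger budget it is also optimal at `x`, against the maximality of `a x`.
  by_contra! hlt
  obtain ⟨⟨hax, haxm⟩, hgx⟩ := ha x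
  obtain ⟨hay, haym⟩ := (ha y).1
  have hyx : a y ∈ M.feasibleParams n 0 x := by
    refine ⟨hay.1, le_trans ?_ hax.2⟩
    exact h.cededPremium_anti (f := layerLoss _ ⟨a x, hax.1⟩) (f' := layerLoss _ ⟨a y, hay.1⟩)
      fun t => layer_mono _ t hlt.le
  exact hlt.not_ge <| hgx ⟨hyx, fun b hb =>
    (haym _ (feasibleParams_mono hxy hax)).trans (haxm b hb)⟩

theorem reducedValue_antitone : Antitone (M.reducedValue n) := fun x y hxy => by
  obtain ⟨a, ha⟩ := h.exists_isReducedMin x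
  rw [← ha.layerCost_eq]
  exact h.reducedValue_le (feasibleParams_mono hxy ha.1)

/-- If the values at `x + 1/(k+1)` all stayed below `r`, a limit of minimizers would be feasible at
`x` with cost at most `r`. The other half is monotonicity. -/
theorem continuousWithinAt_reducedValue (x : ℝ) :
    ContinuousWithinAt (M.reducedValue n) (Ici x) x := by
  refine tendsto_order.2 ⟨fun r hr => ?_, fun r hr => ?_⟩
  · have hex : ∃ k : ℕ, r < M.reducedValue n (x + 1 / ((k : ℝ) + 1)) := by
      by_contra! hle
      choose a ha using fun k : ℕ => h.exists_isReducedMin (x + 1 / ((k : ℝ) + 1))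
      have hlim : Tendsto (fun k : ℕ => x + 1 / ((k : ℝ) + 1)) atTop (𝓝 (x + 0)) :=
        tendsto_const_nhds.add tendsto_one_div_add_atTop_nhds_zero_nat
      rw [add_zero] at hlim
      obtain ⟨a', ha', hle'⟩ := h.exists_layerCost_le_of_tendsto (fun k => (ha k).1) hlim
        (tendsto_const_nhds (x := r)) fun k => (ha k).layerCost_eq.trans_le (hle k)
      exact absurd (hr.trans_le (h.reducedValue_le ha')) hle'.not_gt
    obtain ⟨k, hk⟩ := hex
    have hlt : x < x + 1 / ((k : ℝ) + 1) := lt_add_of_pos_right x (by positivity)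
    filter_upwards [mem_nhdsWithin_of_mem_nhds (Iio_mem_nhds hlt)] with y hy
    exact hk.trans_le (h.reducedValue_antitone (le_of_lt hy))
  · filter_upwards [self_mem_nhdsWithin] with y hy
    exact (h.reducedValue_antitone hy).trans_lt hr

theorem reducedValue_le_staticCost {x : ℝ} {f : RetainedLoss} (hf : f ∈ M.D n x) :
    M.reducedValue n x ≤ M.staticCost n f := by
  obtain ⟨a, ha, haf, hac⟩ := h.exists_layer_le f
  exact (h.reducedValue_le ⟨ha, haf.trans hf⟩).trans hac

theorem staticCost_eq_reducedValue {x : ℝ} {f : RetainedLoss} (hf : M.IsStaticMin n x f) :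
    M.staticCost n f = M.reducedValue n x := by
  refine le_antisymm ?_ (h.reducedValue_le_staticCost hf.1)
  obtain ⟨a, ha⟩ := h.exists_isReducedMin x
  rw [← ha.layerCost_eq, ← h.staticCost_layer ⟨a, ha.1.1⟩]
  exact hf.2 (layerLoss _ ⟨a, ha.1.1⟩) ha.1.2

end IsAdmissible

end Model

/-! ## The dynamic problem -/

theorem History.last_append {n : ℕ} (h : History n) (f : RetainedLoss) (x : ℝ) :
    (h.append f x).last = x := by
  simp [History.append, History.last]

namespace Model

variable {Ω : Type*} [MeasurableSpace Ω] {M : Model Ω} {p : ℝ≥0∞} {n : ℕ}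

theorem append_mem_H {h : History n} (hh : h ∈ M.H n) {f : RetainedLoss}
    (hf : f ∈ M.D n h.last) (x : ℝ) : h.append f x ∈ M.H (n + 1) := by
  intro k
  induction k using Fin.lastCases with
  | last => simpa [History.append, History.last] using hf
  | cast k => simpa [History.append] using hh k

/-- The value function of the dynamic problem when `m` periods remain. -/
def optCost (M : Model Ω) : (m n : ℕ) → ℝ → ℝ
  | 0, _, _ => 0
  | m + 1, n, x => M.reducedValue n x - M.z (n + 1) - x
      + M.β * optCost M m (n + 1) (x + M.z (n + 1) - M.reducedValue n x)

/-- Here `s` is retained loss plus premium: a larger `s` costs more now and leaves less capital, at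
which `U` is larger. -/
theorem monotone_step (hβ : 0 ≤ M.β) {U : ℝ → ℝ} (hU : Antitone U) (x z : ℝ) :
    Monotone fun s => s - z - x + M.β * U (x + z - s) := fun s t hst => by
  have := mul_le_mul_of_nonneg_left (hU (sub_le_sub_left hst (x + z))) hβ
  dsimp only
  linarith

theorem optCost_antitone (hβ : 0 ≤ M.β) (hM : ∀ n < M.N, M.IsAdmissible p n) :
    ∀ m n, n + m ≤ M.N → Antitone (M.optCost m n)
  | 0, _, _ => fun _ _ _ => le_rfl
  | m + 1, n, hn => fun x y hxy => by
    have hJ := (hM n (by omega)).reducedValue_antitone hxy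
    have := mul_le_mul_of_nonneg_left (optCost_antitone hβ hM m (n + 1) (by omega)
      (show x + M.z (n + 1) - M.reducedValue n x ≤ y + M.z (n + 1) - M.reducedValue n y by
        linarith)) hβ
    simp only [optCost]
    linarith

/-- The next capital `x + z - J(x)`, with `J` the minimal static cost, is increasing and
right-continuous, so it approaches its limit from the right and right-continuity survives
composition. -/
theorem continuousWithinAt_optCost (hM : ∀ n < M.N, M.IsAdmissible p n) :
    ∀ m n, n + m ≤ M.N → ∀ x, ContinuousWithinAt (M.optCost m n) (Ici x) x
  | 0, _, _, _ => continuousWithinAt_const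
  | m + 1, n, hn, x => by
    have hJ := (hM n (by omega)).continuousWithinAt_reducedValue x
    refine ((hJ.sub continuousWithinAt_const).sub continuousWithinAt_id).add
      (continuousWithinAt_const.mul ?_)
    refine ContinuousWithinAt.comp (t := Ici (x + M.z (n + 1) - M.reducedValue n x))
      (continuousWithinAt_optCost hM m (n + 1) (by omega) _)
      ((continuousWithinAt_id.add continuousWithinAt_const).sub hJ) fun y hy => ?_
    have := (hM n (by omega)).reducedValue_antitone (show x ≤ y from hy)
    have hxy : x ≤ y := hy
    simp only [mem_Ici]
    linarith

/-- One step of the value iteration with a right-continuous decreasing continuation cost. -/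
theorem IsAdmissible.VaR_step (h : M.IsAdmissible p n) (hβ : 0 ≤ M.β) {U : ℝ → ℝ}
    (hU : Antitone U) (hUc : ∀ x, ContinuousWithinAt U (Ici x) x) (f : RetainedLoss) (x z : ℝ) :
    VaR M.P (M.α n) (fun ω => f (M.Y (n + 1) ω) + M.price n f - z - x
        + M.β * U (x + z - f (M.Y (n + 1) ω) - M.price n f)) =
      M.staticCost n f - z - x + M.β * U (x + z - M.staticCost n f) := by
  have := h.isProbabilityMeasure
  have hc := VaR_comp (P := M.P) h.α_mem (X := fun ω => f (M.Y (n + 1) ω))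
    (f.continuous.measurable.comp h.measurable_Y) (fun ω => f.nonneg _)
    (φ := fun s => s + M.price n f - z - x + M.β * U (x + z - s - M.price n f)) ?_ ?_
  · rw [hc, staticCost, sub_add_eq_sub_sub]
  · intro s t hst
    have := monotone_step hβ hU x z (add_le_add_left hst (M.price n f))
    simpa only [sub_add_eq_sub_sub] using this
  -- As the loss increases to its quantile, the next capital decreases to its limit, so
  -- right-continuity of `U` is what is needed.
  · refine ContinuousWithinAt.add (by fun_prop) (continuousWithinAt_const.mul ?_)
    refine ContinuousWithinAt.comp
      (t := Ici (x + z - VaR M.P (M.α n) (fun ω => f (M.Y (n + 1) ω)) - M.price n f))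
      (hUc _) (by fun_prop) fun y hy => ?_
    have hy' : y ≤ VaR M.P (M.α n) (fun ω => f (M.Y (n + 1) ω)) := hy
    simp only [mem_Ici]
    linarith

theorem optCost_le_valueAux (hβ : 0 ≤ M.β) (hM : ∀ n < M.N, M.IsAdmissible p n)
    {d : (n : ℕ) → History n → RetainedLoss} (hd : M.IsPolicy d) :
    ∀ m n, n + m = M.N → ∀ h ∈ M.H n, M.optCost m n h.last ≤ M.valueAux d m n h
  | 0, _, _, _, _ => le_rfl
  | m + 1, n, hn, h, hh => by
    have hA := hM n (by omega)
    have hanti := optCost_antitone hβ hM m (n + 1) (by omega)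
    have hcont := continuousWithinAt_optCost hM m (n + 1) (by omega)
    have := hA.isProbabilityMeasure
    have hf := (hd n (by omega)).2 h hh
    simp only [optCost, valueAux]
    -- Pass from the minimal static cost to that of `d n h`, then undo `VaR_step` so that
    -- continuation costs can be compared pointwise under `VaR`.
    refine (monotone_step hβ hanti h.last (M.z (n + 1))
      (hA.reducedValue_le_staticCost hf)).trans ?_
    dsimp only
    rw [← hA.VaR_step hβ hanti hcont (d n h)]
    -- The constant is the one-period expression at zero retained loss, where it is smallest.
    refine VaR_mono (c := M.price n (d n h) - M.z (n + 1) - h.last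
      + M.β * M.optCost m (n + 1) (h.last + M.z (n + 1) - M.price n (d n h))) hA.α_mem
      (fun ω => ?_) fun ω => ?_
    · have h0 := (d n h).nonneg (M.Y (n + 1) ω)
      have := mul_le_mul_of_nonneg_left (hanti (show h.last + M.z (n + 1)
        - d n h (M.Y (n + 1) ω) - M.price n (d n h) ≤
          h.last + M.z (n + 1) - M.price n (d n h) by linarith)) hβ
      linarith
    · refine add_le_add_right (mul_le_mul_of_nonneg_left ?_ hβ) _
      have := optCost_le_valueAux hβ hM hd m (n + 1) (by omega) _
        (append_mem_H hh hf (h.last + M.z (n + 1) - d n h (M.Y (n + 1) ω) - M.price n (d n h)))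
      rwa [History.last_append] at this

/-- No feasibility of the history is needed: the rules are optimal in every state, and the
continuation value depends on the last state only. -/
theorem valueAux_markov (hβ : 0 ≤ M.β) (hM : ∀ n < M.N, M.IsAdmissible p n)
    {δ : ℕ → ℝ → RetainedLoss} (hδ : ∀ n < M.N, ∀ x, M.IsStaticMin n x (δ n x)) :
    ∀ m n, n + m = M.N → ∀ h : History n,
      M.valueAux (markov δ) m n h = M.optCost m n h.last
  | 0, _, _, _ => rfl
  | m + 1, n, hn, h => by
    have hA := hM n (by omega)
    simp only [optCost, valueAux, valueAux_markov hβ hM hδ m (n + 1) (by omega),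
      History.last_append]
    rw [hA.VaR_step hβ (optCost_antitone hβ hM m (n + 1) (by omega))
      (continuousWithinAt_optCost hM m (n + 1) (by omega)), markov,
      hA.staticCost_eq_reducedValue (hδ n (by omega) h.last)]

/-- Myopic policies are optimal. -/
theorem isOptimal_markov (hβ : 0 ≤ M.β) (hM : ∀ n < M.N, M.IsAdmissible p n)
    {δ : ℕ → ℝ → RetainedLoss} (hpol : M.IsPolicy (markov δ))
    (hδ : ∀ n < M.N, ∀ x, M.IsStaticMin n x (δ n x)) : M.IsOptimal (markov δ) := by
  refine ⟨hpol, fun d hd n hn h hh => ?_⟩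
  have hN : n + (M.N - n) = M.N := by omega
  rw [value, value, valueAux_markov hβ hM hδ _ n hN]
  exact optCost_le_valueAux hβ hM hd _ n hN h hh

/-- Antitone solutions of the reduced problems yield an optimal Markov policy of layer treaties. -/
theorem exists_isOptimal_layer (hβ : 0 ≤ M.β) (hM : ∀ n < M.N, M.IsAdmissible p n)
    {a : ℕ → ℝ → ℝ} (hanti : ∀ n < M.N, Antitone (a n))
    (ha : ∀ n < M.N, ∀ x, M.IsReducedMin n x (a n x)) :
    ∃ δ : ℕ → ℝ → RetainedLoss,
      (∀ n < M.N, ∀ x, (∀ t, δ n x t = layer (M.claimVaR n) (a n x) t) ∧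
        M.IsStaticMin n x (δ n x)) ∧ M.IsOptimal (markov δ) := by
  have hmem : ∀ n < M.N, ∀ x, a n x ∈ Icc 0 (M.claimVaR n) := fun n hn x => (ha n hn x).1.1
  have : Nonempty RetainedLoss := ⟨layerLoss 0 ⟨0, le_rfl, le_rfl⟩⟩
  classical
  let δ : ℕ → ℝ → RetainedLoss := fun n x =>
    if hn : n < M.N then layerLoss (M.claimVaR n) ⟨a n x, hmem n hn x⟩ else Classical.arbitrary _
  have hδ : ∀ n (hn : n < M.N) x, δ n x = layerLoss (M.claimVaR n) ⟨a n x, hmem n hn x⟩ :=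
    fun n hn x => dif_pos hn
  have hmin : ∀ n < M.N, ∀ x, M.IsStaticMin n x (δ n x) := fun n hn x => by
    rw [hδ n hn]
    exact (hM n hn).isStaticMin_layerLoss (ha n hn x)
  refine ⟨δ, fun n hn x => ⟨fun t => by rw [hδ n hn]; rfl, hmin n hn x⟩,
    isOptimal_markov hβ hM (fun n hn => ⟨?_, fun h _ => (hmin n hn h.last).1⟩) hmin⟩
  -- An antitone deductible is Borel, and the layer depends continuously on it.
  have hm : Measurable (δ n) := by
    rw [funext (hδ n hn)]
    exact (continuous_layerLoss _).measurable.comp (hanti n hn).measurable.subtype_mk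
  exact hm.comp ((measurable_pi_apply _).comp (measurable_fst.comp measurable_subtype_coe))

end Model

/-! ## The Wang premium principle -/

section Wang

theorem distFun_eq_map {Ω : Type*} [MeasurableSpace Ω] {P : Measure Ω} {X : Ω → ℝ} (hX : AEMeasurable X P) (x : ℝ) :
    distFun P X x = (P.map X).real (Iic x) :=
  (map_measureReal_apply_of_aemeasurable hX measurableSet_Iic).symm

variable {Ω : Type*} [MeasurableSpace Ω] {P : Measure Ω} [IsProbabilityMeasure P] {g : ℝ → ℝ}

theorem survival_mono_ae {X X' : Ω → ℝ} (h : X ≤ᵐ[P] X') (x : ℝ) :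
    survival P X x ≤ survival P X' x := by
  refine sub_le_sub_left (ENNReal.toReal_mono (measure_ne_top _ _) (measure_mono_ae ?_)) 1
  filter_upwards [h] with ω hω hx using hω.trans hx

/-- Survival functions are lower semicontinuous under almost sure convergence. -/
theorem eventually_lt_survival {X : ℕ → Ω → ℝ} {X' : Ω → ℝ} (hX : ∀ k, AEMeasurable (X k) P)
    (hlim : ∀ᵐ ω ∂P, Tendsto (fun k => X k ω) atTop (𝓝 (X' ω))) {s y : ℝ}
    (hs : s < survival P X' y) : ∀ᶠ k in atTop, s < survival P (X k) y := by
  -- These sets decrease to the limit superior of the events `X k ≤ y`, which almost surely lies in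
  -- `X' ≤ y`.
  have hanti : Antitone fun K : ℕ => ⋃ k ≥ K, {ω | X k ω ≤ y} := fun i j hij =>
    biUnion_subset_biUnion_left fun k hk => le_trans hij hk
  have ht := tendsto_measure_iInter_atTop (μ := P) (fun K =>
    NullMeasurableSet.biUnion (to_countable _) fun k _ =>
      nullMeasurableSet_le (hX k) aemeasurable_const) hanti ⟨0, measure_ne_top _ _⟩
  have hle : P (⋂ K, ⋃ k ≥ K, {ω | X k ω ≤ y}) ≤ P {ω | X' ω ≤ y} := by
    refine measure_mono_ae ?_
    filter_upwards [hlim] with ω hω hmem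
    refine le_of_not_gt fun hlt => ?_
    obtain ⟨K, hK⟩ := eventually_atTop.1 (hω.eventually (lt_mem_nhds hlt))
    obtain ⟨k, hk, hky⟩ := mem_iUnion₂.1 (mem_iInter.1 hmem K)
    exact absurd (hK k hk) (not_lt.2 hky)
  have ht' := (ENNReal.tendsto_toReal (measure_ne_top P _)).comp ht
  have hlt : (P (⋂ K, ⋃ k ≥ K, {ω | X k ω ≤ y})).toReal < 1 - s := by
    refine lt_of_le_of_lt (ENNReal.toReal_mono (measure_ne_top _ _) hle) ?_
    have : s < 1 - distFun P X' y := hs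
    change distFun P X' y < 1 - s
    linarith
  obtain ⟨K, hK⟩ := eventually_atTop.1 (ht'.eventually (gt_mem_nhds hlt))
  filter_upwards [eventually_ge_atTop K] with k hk
  have h1 : distFun P (X k) y ≤ P.real (⋃ k ≥ K, {ω | X k ω ≤ y}) :=
    measureReal_mono (subset_biUnion_of_mem (u := fun k => {ω | X k ω ≤ y}) hk)
      (measure_ne_top _ _)
  have h2 : P.real (⋃ k ≥ K, {ω | X k ω ≤ y}) < 1 - s := hK K le_rfl
  change s < 1 - distFun P (X k) y
  linarith

theorem IsDistortion.nonneg (hg : IsDistortion g) {u : ℝ} (hu : u ∈ Icc (0 : ℝ) 1) : 0 ≤ g u :=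
  hg.map_zero.symm.trans_le (hg.monotoneOn ⟨le_rfl, zero_le_one⟩ hu hu.1)

theorem IsDistortion.comp_survival_antitone (hg : IsDistortion g) (X : Ω → ℝ) :
    Antitone fun x => g (survival P X x) := fun _ _ hxy =>
  hg.monotoneOn (survival_mem_Icc X _) (survival_mem_Icc X _) (survival_antitone X hxy)

/-- Increasing left-continuous functions are lower semicontinuous. -/
theorem IsLeftContinuous.exists_lt (hgl : IsLeftContinuous g) {u r : ℝ}
    (hu : u ∈ Ioc (0 : ℝ) 1) (hr : r < g u) : ∃ s ∈ Ico 0 u, r < g s := by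
  have hc := (hgl u ⟨hu.1.le, hu.2⟩).mono Ico_subset_Icc_self
  have hne : (𝓝[Ico 0 u] u).NeBot := by
    rw [nhdsWithin_Ico_eq_nhdsLT hu.1]
    infer_instance
  obtain ⟨s, hs, hsu⟩ := ((hc.eventually (lt_mem_nhds hr)).and self_mem_nhdsWithin).exists
  exact ⟨s, hsu, hs⟩

/-- The substance is the Fatou property: lower semicontinuity of survival functions and of `g`
bounds the integrand by the limit inferior, and Fatou's lemma integrates this. -/
theorem isPremiumPrinciple_of_eq_wangPremium {p : ℝ≥0∞} {θ : ℝ} {π : (Ω → ℝ) → EReal}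
    (hg : IsDistortion g) (hgl : IsLeftContinuous g) (hθ : 0 ≤ θ)
    (hπ : ∀ X, MemLpPos P p X → π X = wangPremium P g θ X) : IsPremiumPrinciple P p π where
  law_invariant X X' hX hX' h := by
    rw [hπ X hX, hπ X' hX']
    simp only [wangPremium, survival, distFun_eq_map hX.1.aemeasurable,
      distFun_eq_map hX'.1.aemeasurable, h]
  monotone X X' hX hX' h := by
    rw [hπ X hX, hπ X' hX']
    refine EReal.coe_ennreal_le_coe_ennreal_iff.2 (mul_le_mul_right (lintegral_mono fun x => ?_) _)
    exact ENNReal.ofReal_le_ofReal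
      (hg.monotoneOn (survival_mem_Icc X x) (survival_mem_Icc X' x) (survival_mono_ae h x))
  normalized := by
    rw [hπ _ ⟨MemLp.zero', ae_of_all _ fun _ => le_rfl⟩, wangPremium,
      setLIntegral_congr_fun (g := fun _ => 0) measurableSet_Ioi fun x hx => ?_]
    · simp
    · have hx' : (0 : ℝ) ≤ x := le_of_lt hx
      simp [survival, distFun, hx', hg.map_zero]
  fatou X X' B hX hX' _ _ hlim := by
    have hθ'' : 0 < 1 + θ := by linarith
    have hθ' := hθ''.le
    simp only [fun k => hπ (X k) (hX k), hπ X' hX', wangPremium]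
    have hm : ∀ k, Measurable fun x =>
        ENNReal.ofReal (1 + θ) * ENNReal.ofReal (g (survival P (X k) x)) := fun k =>
      (hg.comp_survival_antitone (X k)).measurable.ennreal_ofReal.const_mul _
    have hcoe := Monotone.map_liminf_of_continuousAt (F := atTop) (f := ((↑) : ℝ≥0∞ → EReal))
      (fun _ _ h => EReal.coe_ennreal_le_coe_ennreal_iff.2 h)
      (fun k => ENNReal.ofReal (1 + θ) *
        ∫⁻ x in Ioi (0 : ℝ), ENNReal.ofReal (g (survival P (X k) x)))
      continuous_coe_ennreal_ereal.continuousAt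
    refine le_trans (EReal.coe_ennreal_le_coe_ennreal_iff.2 ?_) hcoe.le
    simp only [← lintegral_const_mul' _ _ ENNReal.ofReal_ne_top]
    refine le_trans (lintegral_mono fun y => ?_) (lintegral_liminf_le hm)
    have hu := survival_mem_Icc (P := P) X' y
    -- At survival probability `0` there is no room to approach from the left, but there `g`
    -- vanishes.
    rcases hu.1.eq_or_lt with h0 | h0
    · simp [← h0, hg.map_zero]
    refine le_of_forall_lt_imp_le_of_dense fun r hr => ?_
    have hrt := hr.ne_top
    rw [← ENNReal.ofReal_mul hθ', ENNReal.lt_ofReal_iff_toReal_lt hrt, mul_comm,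
      ← div_lt_iff₀ hθ''] at hr
    obtain ⟨s, hs, hsr⟩ := hgl.exists_lt ⟨h0, hu.2⟩ hr
    refine le_liminf_of_le (by isBoundedDefault) ?_
    filter_upwards [eventually_lt_survival (fun k => (hX k).1.aemeasurable) hlim hs.2] with k hk
    have hgs := hg.monotoneOn ⟨hs.1, hs.2.le.trans hu.2⟩ (survival_mem_Icc (X k) y) hk.le
    rw [← ENNReal.ofReal_mul hθ', ← ENNReal.ofReal_toReal hrt, mul_comm]
    exact ENNReal.ofReal_le_ofReal ((div_le_iff₀ hθ'').1 (hsr.le.trans hgs))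

end Wang

/-! ### Wang premiums of layer treaties -/

namespace Model

variable {Ω : Type*} [MeasurableSpace Ω] {M : Model Ω} {p : ℝ≥0∞} {n : ℕ} {g : ℝ → ℝ} {θ : ℝ}

/-- The ceded loss is `min((Y - a)⁺, v - a)`. Its survival function at `y > 0` is `S_Y(a + y)` for
`y < v - a` and `0` afterwards; translate by `a`. -/
theorem cededPremium_layer_of_eq_wangPremium [IsProbabilityMeasure M.P]
    (hYm : Measurable (M.Y (n + 1))) (hYp : MemLp (M.claim n) p M.P)
    (hg : IsDistortion g) (hθ : 0 ≤ θ)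
    (hw : ∀ X, MemLpPos M.P p X → M.premium n X = wangPremium M.P g θ X)
    {a : ℝ} (ha : a ∈ Icc 0 (M.claimVaR n)) :
    M.cededPremium n (layer (M.claimVaR n) a) =
      (((1 + θ) * ∫ y in a..M.claimVaR n, g (survival M.P (M.claim n) y) : ℝ) : EReal) := by
  set v := M.claimVaR n
  have hθ' : 0 ≤ 1 + θ := by linarith
  have hsurv : ∀ y ∈ Ioi (0 : ℝ),
      ENNReal.ofReal (g (survival M.P (fun ω => M.claim n ω - layer v a (M.Y (n + 1) ω)) y)) =
        (Iio (v - a)).indicator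
          (fun y => ENNReal.ofReal (g (survival M.P (M.claim n) (a + y)))) y := by
    intro y hy
    have hy' : 0 < y := hy
    by_cases hyv : y < v - a
    · rw [indicator_of_mem (show y ∈ Iio (v - a) from hyv), survival, distFun, survival, distFun]
      congr 5
      ext ω
      simp only [layer, claim]
      constructor
      · intro h
        rcases max_cases (min a (M.Y (n + 1) ω : ℝ)) (M.Y (n + 1) ω - v + a) with h1 | h1 <;>
        rcases min_cases a (M.Y (n + 1) ω : ℝ) with h3 | h3 <;> linarith
      · intro h
        rcases min_cases a (M.Y (n + 1) ω : ℝ) with h3 | h3 <;>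
        linarith [le_max_left (min a (M.Y (n + 1) ω : ℝ)) (M.Y (n + 1) ω - v + a)]
    · rw [indicator_of_notMem (show y ∉ Iio (v - a) from hyv)]
      have : {ω | M.claim n ω - layer v a (M.Y (n + 1) ω) ≤ y} = univ := by
        refine eq_univ_of_forall fun ω => ?_
        have := le_max_right (min a (M.Y (n + 1) ω : ℝ)) (M.Y (n + 1) ω - v + a)
        simp only [mem_ofPred_eq, layer, claim]
        linarith
      rw [survival, distFun, this, probReal_univ, sub_self, hg.map_zero, ENNReal.ofReal_zero]
  have hanti : Antitone fun y => g (survival M.P (M.claim n) (a + y)) := fun y y' hyy' =>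
    hg.comp_survival_antitone (M.claim n) (add_le_add_right hyy' a)
  have hnn : ∀ y, 0 ≤ g (survival M.P (M.claim n) y) := fun y => hg.nonneg (survival_mem_Icc _ _)
  have hint : ∫⁻ y in Ioi (0 : ℝ), ENNReal.ofReal
      (g (survival M.P (fun ω => M.claim n ω - layer v a (M.Y (n + 1) ω)) y)) =
        ENNReal.ofReal (∫ y in a..v, g (survival M.P (M.claim n) y)) := by
    rw [setLIntegral_congr_fun measurableSet_Ioi hsurv, setLIntegral_indicator measurableSet_Iio,
      inter_comm, Ioi_inter_Iio, setLIntegral_congr Ioo_ae_eq_Ioc,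
      ← ofReal_integral_eq_lintegral_ofReal
        (hanti.intervalIntegrable (a := 0) (b := v - a)).1 (ae_of_all _ fun y => hnn _),
      ← intervalIntegral.integral_of_le (sub_nonneg.2 ha.2)]
    rw [intervalIntegral.integral_comp_add_left (fun y => g (survival M.P (M.claim n) y)),
      add_zero, add_sub_cancel]
  refine (hw _ (memLpPos_ceded hYm hYp (layerLoss v ⟨a, ha⟩))).trans ?_
  simp only [wangPremium, layerLoss_apply]
  rw [hint, ← ENNReal.ofReal_mul hθ', EReal.coe_ennreal_ofReal, max_eq_left]
  exact mul_nonneg hθ' (intervalIntegral.integral_nonneg ha.2 fun y _ => hnn y)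

theorem layerCost_of_eq_wangPremium [IsProbabilityMeasure M.P]
    (hYm : Measurable (M.Y (n + 1))) (hYp : MemLp (M.claim n) p M.P)
    (hg : IsDistortion g) (hθ : 0 ≤ θ)
    (hw : ∀ X, MemLpPos M.P p X → M.premium n X = wangPremium M.P g θ X)
    {a : ℝ} (ha : a ∈ Icc 0 (M.claimVaR n)) :
    M.layerCost n a =
      a + ∫ y in a..M.claimVaR n, (1 + θ) * g (survival M.P (M.claim n) y) := by
  rw [layerCost, price, cededPremium_layer_of_eq_wangPremium hYm hYp hg hθ hw ha,
    EReal.toReal_coe, intervalIntegral.integral_const_mul]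

/-! ### Sign of the marginal cost on either side of `a*` -/

section aStar

variable [IsProbabilityMeasure M.P] (hα : M.α n ∈ Ioo (0 : ℝ) 1) (hg : IsDistortion g)
  (hθ : 0 ≤ θ)
include hα hg hθ

/-- Makes the infimum defining `aStar` one over a nonempty set: the quantile is attained, so `S(v) ≤
1 - α`, and `g` is increasing. -/
theorem claimVaR_mem_aStar_set (h : g (1 - M.α n) < 1 / (1 + θ))
    (hYm : Measurable (M.Y (n + 1))) :
    M.claimVaR n ∈ {a | a ∈ Icc 0 (M.claimVaR n) ∧
      0 ≤ 1 - (1 + θ) * g (survival M.P (M.claim n) a)} := by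
  refine ⟨⟨claimVaR_nonneg hα, le_rfl⟩, ?_⟩
  have hm : Measurable (M.claim n) := hYm.coe_nnreal_real
  have h1 : survival M.P (M.claim n) (M.claimVaR n) ≤ 1 - M.α n :=
    sub_le_sub_left (le_distFun_VaR hα.2 hm) 1
  have h2 := hg.monotoneOn (survival_mem_Icc _ _)
    ⟨sub_nonneg.2 hα.2.le, sub_le_self 1 hα.1.le⟩ h1
  have h3 := (h2.trans_lt h).le
  rw [le_div_iff₀ (by linarith)] at h3
  linarith

theorem aStar_mem (hYm : Measurable (M.Y (n + 1))) :
    M.aStar g θ n ∈ Icc 0 (M.claimVaR n) := by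
  unfold aStar
  split_ifs with h
  · have hv := claimVaR_mem_aStar_set hα hg hθ h hYm
    exact ⟨le_csInf ⟨_, hv⟩ fun a ha => ha.1.1, csInf_le ⟨0, fun a ha => ha.1.1⟩ hv⟩
  · exact ⟨claimVaR_nonneg hα, le_rfl⟩

theorem one_le_of_lt_aStar (hYm : Measurable (M.Y (n + 1))) {y : ℝ} (hy : 0 ≤ y)
    (hya : y < M.aStar g θ n) : 1 ≤ (1 + θ) * g (survival M.P (M.claim n) y) := by
  have hyv := hya.trans_le (aStar_mem hα hg hθ hYm).2
  unfold aStar at hya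
  split_ifs at hya with h
  · by_contra! hlt
    exact absurd (csInf_le (s := {a | a ∈ Icc 0 (M.claimVaR n) ∧
      0 ≤ 1 - (1 + θ) * g (survival M.P (M.claim n) a)}) ⟨0, fun a ha => ha.1.1⟩
      ⟨⟨hy, hyv.le⟩, by linarith⟩) hya.not_ge
  -- Here `a* = v`, and a point below the quantile has survival probability at least `1 - α`.
  · have h1 : distFun M.P (M.claim n) y < M.α n := by
      by_contra! hle
      exact absurd (VaR_le hα.1 claim_nonneg hle) hyv.not_ge
    have h2 : 1 - M.α n ≤ survival M.P (M.claim n) y := sub_le_sub_left h1.le 1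
    have h3 := (not_lt.1 h).trans (hg.monotoneOn
      ⟨sub_nonneg.2 hα.2.le, sub_le_self 1 hα.1.le⟩ (survival_mem_Icc _ _) h2)
    rw [div_le_iff₀ (by linarith)] at h3
    linarith

theorem le_one_of_aStar_lt (hYm : Measurable (M.Y (n + 1))) {y : ℝ} (hyv : y ≤ M.claimVaR n)
    (hya : M.aStar g θ n < y) : (1 + θ) * g (survival M.P (M.claim n) y) ≤ 1 := by
  unfold aStar at hya
  split_ifs at hya with h
  · obtain ⟨b, hb, hby⟩ := exists_lt_of_csInf_lt
      ⟨_, claimVaR_mem_aStar_set hα hg hθ h hYm⟩ hya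
    have := mul_le_mul_of_nonneg_left (hg.comp_survival_antitone (P := M.P) (M.claim n) hby.le)
      (show 0 ≤ 1 + θ by linarith)
    linarith [hb.2]
  · exact absurd hyv hya.not_ge

end aStar

/-! ### Optimal deductibles without and with the budget constraint -/

section Optimality

variable (h : M.IsAdmissible p n) (hg : IsDistortion g) (hθ : 0 ≤ θ)
  (hw : ∀ X, MemLpPos M.P p X → M.premium n X = wangPremium M.P g θ X)
include h hg hθ hw

/-- The cost of a layer treaty decreases up to `a*_n` and increases afterwards. -/
theorem layerCost_anti_mono :
    AntitoneOn (M.layerCost n) (Icc 0 (M.aStar g θ n)) ∧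
      MonotoneOn (M.layerCost n) (Icc (M.aStar g θ n) (M.claimVaR n)) := by
  have := h.isProbabilityMeasure
  have hs := aStar_mem h.α_mem hg hθ h.measurable_Y
  have hint : ∀ a b, IntervalIntegrable
      (fun y => (1 + θ) * g (survival M.P (M.claim n) y)) volume a b := fun a b =>
    ((hg.comp_survival_antitone (M.claim n)).intervalIntegrable).const_mul _
  -- The cost increment from `a` to `b` is `∫_a^b (1 - (1+θ) g(S))`. Its sign is only needed on the
  -- open interval, so the value at `a*` itself is immaterial.
  have hcost : ∀ a ∈ Icc 0 (M.claimVaR n), ∀ b ∈ Icc 0 (M.claimVaR n), M.layerCost n a =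
      M.layerCost n b + a - b + ∫ y in a..b, (1 + θ) * g (survival M.P (M.claim n) y) := by
    intro a ha b hb
    rw [layerCost_of_eq_wangPremium h.measurable_Y h.memLp_claim hg hθ hw ha,
      layerCost_of_eq_wangPremium h.measurable_Y h.memLp_claim hg hθ hw hb,
      ← intervalIntegral.integral_add_adjacent_intervals (hint a b) (hint b _)]
    ring
  constructor
  · intro a ha b hb hab
    rw [hcost a ⟨ha.1, ha.2.trans hs.2⟩ b ⟨hb.1, hb.2.trans hs.2⟩]
    have := intervalIntegral.integral_mono_on_of_le_Ioo hab
      (intervalIntegrable_const (c := (1 : ℝ))) (hint a b) fun y hy =>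
        one_le_of_lt_aStar h.α_mem hg hθ h.measurable_Y (ha.1.trans hy.1.le) (hy.2.trans_le hb.2)
    rw [intervalIntegral.integral_const, smul_eq_mul, mul_one] at this
    linarith
  · intro a ha b hb hab
    rw [hcost a ⟨hs.1.trans ha.1, ha.2⟩ b ⟨hs.1.trans hb.1, hb.2⟩]
    have := intervalIntegral.integral_mono_on_of_le_Ioo hab
      (hint a b) (intervalIntegrable_const (c := (1 : ℝ))) fun y hy =>
        le_one_of_aStar_lt h.α_mem hg hθ h.measurable_Y (hy.2.le.trans hb.2) (ha.1.trans_lt hy.1)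
    rw [intervalIntegral.integral_const, smul_eq_mul, mul_one] at this
    linarith

theorem layerCost_aStar_le {b : ℝ} (hb : b ∈ Icc 0 (M.claimVaR n)) :
    M.layerCost n (M.aStar g θ n) ≤ M.layerCost n b := by
  have := h.isProbabilityMeasure
  have hs := aStar_mem h.α_mem hg hθ h.measurable_Y
  obtain ⟨hanti, hmono⟩ := layerCost_anti_mono h hg hθ hw
  rcases le_total b (M.aStar g θ n) with hle | hle
  · exact hanti ⟨hb.1, hle⟩ ⟨hs.1, le_rfl⟩ hle
  · exact hmono ⟨le_rfl, hs.2⟩ ⟨hle, hb.2⟩ hle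

theorem staticCost_aStar_le (f : RetainedLoss) :
    M.staticCost n (layer (M.claimVaR n) (M.aStar g θ n)) ≤ M.staticCost n f := by
  have := h.isProbabilityMeasure
  obtain ⟨b, hb, -, hbf⟩ := h.exists_layer_le f
  exact (h.staticCost_layer ⟨_, aStar_mem h.α_mem hg hθ h.measurable_Y⟩).trans_le
    ((layerCost_aStar_le h hg hθ hw hb).trans hbf)

omit hw in
theorem isLeast_aOpt (x : ℝ) :
    IsLeast (M.feasibleParams n (M.aStar g θ n) x) (M.aOpt g θ n x) := by
  have := h.isProbabilityMeasure
  have hs := aStar_mem h.α_mem hg hθ h.measurable_Y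
  have hbdd : BddBelow (M.feasibleParams n (M.aStar g θ n) x) := ⟨_, fun a ha => ha.1.1⟩
  obtain ⟨a, -, hlim, hmem⟩ :=
    exists_seq_tendsto_sInf ⟨_, h.claimVaR_mem_feasibleParams hs.2 x⟩ hbdd
  exact ⟨h.feasibleParams_of_tendsto hs.1 hmem hlim tendsto_const_nhds,
    fun b hb => csInf_le hbdd hb⟩

/-- A feasible `b` below `a*` makes `a*` feasible, so `aOpt` is the unconstrained minimizer `a*`.
Against `b` above `a*`, the least feasible point wins because the cost increases there. -/
theorem isReducedMin_aOpt (x : ℝ) : M.IsReducedMin n x (M.aOpt g θ n x) := by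
  have := h.isProbabilityMeasure
  have hs := aStar_mem h.α_mem hg hθ h.measurable_Y
  obtain ⟨hmem, hlow⟩ := isLeast_aOpt h hg hθ x
  refine ⟨⟨Icc_subset_Icc_left hs.1 hmem.1, hmem.2⟩, fun b hb => ?_⟩
  rcases le_total b (M.aStar g θ n) with hle | hle
  · have hfeas : M.aStar g θ n ∈ M.feasibleParams n (M.aStar g θ n) x :=
      ⟨⟨le_rfl, hs.2⟩, (h.cededPremium_anti (f := layerLoss _ ⟨b, hb.1⟩)
        (f' := layerLoss _ ⟨_, hs⟩) fun t => layer_mono _ t hle).trans hb.2⟩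
    rw [le_antisymm (hlow hfeas) hmem.1.1]
    exact layerCost_aStar_le h hg hθ hw hb.1
  · have hb' : b ∈ M.feasibleParams n (M.aStar g θ n) x := ⟨⟨hle, hb.1.2⟩, hb.2⟩
    exact (layerCost_anti_mono h hg hθ hw).2 hmem.1 hb'.1 (hlow hb')

omit hw in
-- Supplies the measurability of the policy: more capital enlarges the feasible set and lowers its
-- minimum.
theorem aOpt_antitone : Antitone (M.aOpt g θ n) := fun x y hxy =>
  (isLeast_aOpt h hg hθ x).mono (isLeast_aOpt h hg hθ y) (feasibleParams_mono hxy)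

end Optimality

end Model

end Reinsurance

end

/-! ### The main theorem -/

theorem mainTheorem4 {Ω : Type*} [MeasurableSpace Ω] (M : Reinsurance.Model Ω)
    [IsProbabilityMeasure M.P] (p : ℝ≥0∞) (hp : 1 ≤ p) (hp' : p ≠ ∞)
    (hYm : ∀ n, Measurable (M.Y (n + 1)))
    (hYp : ∀ n, MemLp (M.claim n) p M.P)
    (hYindep : iIndepFun (fun n => M.Y (n + 1)) M.P)
    (hz : ∀ n < M.N, 0 ≤ M.z (n + 1))
    (hα : ∀ n < M.N, M.α n ∈ Set.Ioo (0 : ℝ) 1)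
    (hβ : M.β ∈ Set.Ioc (0 : ℝ) 1)
    (hfin : ∀ n < M.N, M.premium n (M.claim n) < ⊤) :
    -- general premium principles
    ((∀ n < M.N, Reinsurance.IsPremiumPrinciple M.P p (M.premium n)) →
      -- Markov policies made up of solutions of the static problems are optimal
      (∀ δ : ℕ → ℝ → Reinsurance.RetainedLoss,
        M.IsPolicy (Reinsurance.markov δ) → (∀ n < M.N, ∀ x, M.IsStaticMin n x (δ n x)) →
          M.IsOptimal (Reinsurance.markov δ)) ∧
      -- every solution of the reduced problem gives a solution of the static problem
      (∀ n < M.N, ∀ x a, M.IsReducedMin n x a → ∃ f : Reinsurance.RetainedLoss,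
        (∀ t, f t = Reinsurance.layer (M.claimVaR n) a t) ∧ M.IsStaticMin n x f) ∧
      -- such a myopic optimal policy exists, and it can be made up of layer treaties
      (∃ (δ : ℕ → ℝ → Reinsurance.RetainedLoss) (a : ℕ → ℝ → ℝ),
        (∀ n < M.N, ∀ x, M.IsReducedMin n x (a n x) ∧
          (∀ t, δ n x t = Reinsurance.layer (M.claimVaR n) (a n x) t) ∧
          M.IsStaticMin n x (δ n x)) ∧
        M.IsOptimal (Reinsurance.markov δ))) ∧
    -- Wang premium principles
    (∀ (g : ℕ → ℝ → ℝ) (θ : ℕ → ℝ),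
      (∀ n < M.N, Reinsurance.IsDistortion (g n) ∧ Reinsurance.IsLeftContinuous (g n) ∧
        0 ≤ θ n) →
      (∀ n < M.N, ∀ X : Ω → ℝ, Reinsurance.MemLpPos M.P p X →
        M.premium n X = Reinsurance.wangPremium M.P (g n) (θ n) X) →
      -- the premium of a layer treaty
      (∀ n < M.N, ∀ a ∈ Set.Icc 0 (M.claimVaR n),
        M.cededPremium n (Reinsurance.layer (M.claimVaR n) a) =
          (((1 + θ n) * ∫ y in a..M.claimVaR n,
            g n (Reinsurance.survival M.P (M.claim n) y) : ℝ) : EReal)) ∧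
      -- `a*_n` is optimal without budget constraint, among layer treaties and among all treaties
      (∀ n < M.N, M.aStar (g n) (θ n) n ∈ Set.Icc 0 (M.claimVaR n) ∧
        (∀ b ∈ Set.Icc 0 (M.claimVaR n),
          M.layerCost n (M.aStar (g n) (θ n) n) ≤ M.layerCost n b) ∧
        (∀ f : Reinsurance.RetainedLoss,
          M.staticCost n (Reinsurance.layer (M.claimVaR n) (M.aStar (g n) (θ n) n)) ≤
            M.staticCost n f)) ∧
      -- `a_n(x)` is a minimum and solves the reduced problem
      (∀ n < M.N, ∀ x,
        IsLeast (M.feasibleParams n (M.aStar (g n) (θ n) n) x) (M.aOpt (g n) (θ n) n x) ∧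
        M.IsReducedMin n x (M.aOpt (g n) (θ n) n x)) ∧
      -- the layer treaties `h_{a_n(x)}` form an optimal policy
      (∃ δ : ℕ → ℝ → Reinsurance.RetainedLoss,
        (∀ n < M.N, ∀ x,
          (∀ t, δ n x t = Reinsurance.layer (M.claimVaR n) (M.aOpt (g n) (θ n) n x) t) ∧
          M.IsStaticMin n x (δ n x)) ∧
        M.IsOptimal (Reinsurance.markov δ))) := by
  have hadm : (∀ n < M.N, Reinsurance.IsPremiumPrinciple M.P p (M.premium n)) →
      ∀ n < M.N, M.IsAdmissible p n := fun hπ n hn =>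
    ⟨inferInstance, hYm n, hYp n, hα n hn, hfin n hn, hπ n hn⟩
  refine ⟨fun hπ => ?_, fun g θ hg hw => ?_⟩
  · have hM := hadm hπ
    refine ⟨fun δ hpol hδ => Reinsurance.Model.isOptimal_markov hβ.1.le hM hpol hδ,
      fun n hn x a ha => ⟨Reinsurance.layerLoss (M.claimVaR n) ⟨a, ha.1.1⟩, fun _ => rfl,
        (hM n hn).isStaticMin_layerLoss ha⟩, ?_⟩
    -- Placing `n < M.N` under the existential lets `choose` produce a deductible for every `n`,
    -- with a dummy value beyond the horizon.
    have hex : ∀ n, ∃ a : ℝ → ℝ, n < M.N → Antitone a ∧ ∀ x, M.IsReducedMin n x (a x) := by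
      intro n
      by_cases hn : n < M.N
      · obtain ⟨a, ha⟩ := (hM n hn).exists_antitone_isReducedMin
        exact ⟨a, fun _ => ha⟩
      · exact ⟨fun _ => 0, fun h => absurd h hn⟩
    choose a ha using hex
    obtain ⟨δ, hδ, hopt⟩ := Reinsurance.Model.exists_isOptimal_layer hβ.1.le hM
      (fun n hn => (ha n hn).1) fun n hn => (ha n hn).2
    exact ⟨δ, a, fun n hn x => ⟨(ha n hn).2 x, hδ n hn x⟩, hopt⟩
  · have hM := hadm fun n hn => Reinsurance.isPremiumPrinciple_of_eq_wangPremium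
      (hg n hn).1 (hg n hn).2.1 (hg n hn).2.2 (hw n hn)
    refine ⟨fun n hn a ha => ?_, fun n hn => ⟨?_, fun b hb => ?_, fun f => ?_⟩,
      fun n hn x => ⟨?_, ?_⟩, ?_⟩
    · exact Reinsurance.Model.cededPremium_layer_of_eq_wangPremium (hYm n) (hYp n)
        (hg n hn).1 (hg n hn).2.2 (hw n hn) ha
    · exact Reinsurance.Model.aStar_mem (hα n hn) (hg n hn).1 (hg n hn).2.2 (hYm n)
    · exact Reinsurance.Model.layerCost_aStar_le (hM n hn) (hg n hn).1 (hg n hn).2.2 (hw n hn) hb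
    · exact Reinsurance.Model.staticCost_aStar_le (hM n hn) (hg n hn).1 (hg n hn).2.2 (hw n hn) f
    · exact Reinsurance.Model.isLeast_aOpt (hM n hn) (hg n hn).1 (hg n hn).2.2 x
    · exact Reinsurance.Model.isReducedMin_aOpt (hM n hn) (hg n hn).1 (hg n hn).2.2 (hw n hn) x
    · exact Reinsurance.Model.exists_isOptimal_layer hβ.1.le hM
        (fun n hn => Reinsurance.Model.aOpt_antitone (hM n hn) (hg n hn).1 (hg n hn).2.2)
        fun n hn x => Reinsurance.Model.isReducedMin_aOpt (hM n hn) (hg n hn).1 (hg n hn).2.2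
          (hw n hn) x
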